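/- Let $n$ be a positive integer and let $S$ be a set of $2n+1$ points in the Euclidean plane in general position, i.e. no three points of $S$ are collinear and no four points of $S$ lie on a common circle. Call a circle halving with respect to $S$ if it has three points of $S$ on its circumference, $n-1$ points of $S$ in its interior and $n-1$ points of $S$ in its exterior. Then there are exactly $n^2$ halving circles with respect to $S$. -/

import Mathlib

/-- The Euclidean plane. -/
abbrev Plane : Type := EuclideanSpace ℝ (Fin 2)

/-- A finite set of points of the plane is in general position if no three of its points are
collinear and no four of them are concyclic. -/
def InGeneralPosition (S : Finset Plane) : Prop :=
  (∀ T ⊆ S, T.card = 3 → ¬ Collinear ℝ (T : Set Plane)) ∧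
  (∀ T ⊆ S, T.card = 4 → ¬ EuclideanGeometry.Concyclic (T : Set Plane))

/-- For a set `S` of `2 * n + 1` points, the circle `C` is halving if it has three points of `S`
on its circumference, `n - 1` in its interior and `n - 1` in its exterior. The last two
conditions are written as "the number of points plus one is `n`", which avoids truncated
subtraction. -/
structure IsHalvingCircle (n : ℕ) (S : Finset Plane) (C : EuclideanGeometry.Sphere Plane) :
    Prop where
  radius_pos : 0 < C.radius
  card_on : {p : Plane | p ∈ S ∧ p ∈ C}.ncard = 3
  card_inside : {p : Plane | p ∈ S ∧ dist p C.center < C.radius}.ncard + 1 = n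
  card_outside : {p : Plane | p ∈ S ∧ C.radius < dist p C.center}.ncard + 1 = n

open Finset EuclideanGeometry Classical


/-! Every set `R` of `s + 3` points in general position has `2 * (s + 1)` circles through three of
its points with all other points on one side, inside and outside circles counted together
(`sum_empty_add_full`). To see this, order `R` by a generic linear functional. Inversion at `p`
turns circles through `p` into lines. A triple with middle point `p` has all other points on one
side exactly when its line carries the upper or lower hull edge crossing the axis between the
smaller and the larger points. So each of the `s + 1` non-extreme points is the middle of two such
triples.

Double counting triples in `(s + 3)`-subsets of `S` then gives every binomial moment of the numbers
of interior and exterior points. Moments determine a finite sequence, so with `S.card = m + 2` the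
circles with `k` points inside plus those with `k` outside number `2 * (k + 1) * (m - k)`. At the
middle value of `k` both counts are of the same circles, so half of this is the answer. -/

/-! ### Supporting lines across an axis -/

/-- There is a unique plane `y = c * z + s * w` through two points on different sides of
`w = 0`. -/
theorem existsUnique_coefficients {yq zq wq yr zr wr : ℝ} (hzq : 0 < zq) (hzr : 0 < zr)
    (hwq : wq < 0) (hwr : 0 < wr) :
    ∃ c s : ℝ, (yq = c * zq + s * wq ∧ yr = c * zr + s * wr) ∧
      ∀ c' s' : ℝ, yq = c' * zq + s' * wq → yr = c' * zr + s' * wr → c' = c ∧ s' = s := by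
  have h1 := mul_pos hzq hwr
  have h2 := mul_pos hzr (neg_pos.2 hwq)
  have hD : zq * wr - zr * wq ≠ 0 := by nlinarith
  refine ⟨(yq * wr - yr * wq) / (zq * wr - zr * wq), (zq * yr - zr * yq) / (zq * wr - zr * wq),
    ⟨?_, ?_⟩, fun c' s' e1 e2 => ⟨?_, ?_⟩⟩
  · rw [div_mul_eq_mul_div, div_mul_eq_mul_div, ← add_div, eq_div_iff hD]; ring
  · rw [div_mul_eq_mul_div, div_mul_eq_mul_div, ← add_div, eq_div_iff hD]; ring
  · rw [eq_div_iff hD, e1, e2]; ring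
  · rw [eq_div_iff hD, e1, e2]; ring

/-- Among the planes `y = c * z + s * w` through a point of `A` and a point of `B`, exactly one
has all the other points on its lower side. -/
theorem existsUnique_supporting_pair {α : Type*} [DecidableEq α] (A B : Finset α) (hA : A.Nonempty)
    (hB : B.Nonempty) (w y z : α → ℝ) (hzA : ∀ a ∈ A, 0 < z a) (hzB : ∀ b ∈ B, 0 < z b)
    (hwA : ∀ a ∈ A, w a < 0) (hwB : ∀ b ∈ B, 0 < w b)
    (hgen : ∀ a ∈ A, ∀ b ∈ B, ∀ t ∈ A ∪ B, ∀ c s : ℝ, y a = c * z a + s * w a →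
      y b = c * z b + s * w b → y t = c * z t + s * w t → t = a ∨ t = b) :
    ∃! x : α × α, x ∈ A ×ˢ B ∧ ∃ c s : ℝ, y x.1 = c * z x.1 + s * w x.1 ∧
      y x.2 = c * z x.2 + s * w x.2 ∧
      ∀ t ∈ A ∪ B, t ≠ x.1 → t ≠ x.2 → y t < c * z t + s * w t := by
  have hsol : ∀ a ∈ A, ∀ b ∈ B, ∃ c s : ℝ, y a = c * z a + s * w a ∧ y b = c * z b + s * w b := by
    intro a ha b hb
    obtain ⟨c, s, h, -⟩ := existsUnique_coefficients (yq := y a) (yr := y b)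
      (hzA a ha) (hzB b hb) (hwA a ha) (hwB b hb)
    exact ⟨c, s, h⟩
  choose! c s hca hcb using hsol
  -- In the coordinates `(w / z, y / z)` the plane is a line and `c` is its height on the axis `w =
  -- 0`. The upper hull edge over the axis is the pair of greatest height.
  obtain ⟨⟨a, b⟩, hab, hmax⟩ := (A ×ˢ B).exists_max_image (fun x => c x.1 x.2) (hA.product hB)
  obtain ⟨ha, hb⟩ := mem_product.1 hab
  simp only at ha hb hmax
  have hbelow : ∀ t ∈ A ∪ B, t ≠ a → t ≠ b → y t < c a b * z t + s a b * w t := by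
    intro t ht hta htb
    by_contra! hle
    have hne : y t ≠ c a b * z t + s a b * w t := fun h =>
      (hgen a ha b hb t ht _ _ (hca a ha b hb) (hcb a ha b hb) h).elim hta htb
    have hlt := lt_of_le_of_ne hle hne.symm
    have e1 := hca a ha b hb
    have e2 := hcb a ha b hb
    -- If `t` lay above the line, replacing the endpoint on its side by `t` would raise the
    -- crossing.
    rcases mem_union.1 ht with h | h
    · have f1 := hca t h b hb
      have f2 := hcb t h b hb
      have hm := hmax (t, b) (mem_product.2 ⟨h, hb⟩)
      simp only at hm
      have hs : s a b - s t b ≤ 0 := by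
        have : (s a b - s t b) * w b = (c t b - c a b) * z b := by linarith
        have h3 : (c t b - c a b) * z b ≤ 0 :=
          mul_nonpos_of_nonpos_of_nonneg (by linarith) (hzB b hb).le
        by_contra! h4
        nlinarith [mul_pos h4 (hwB b hb)]
      nlinarith [mul_nonneg (neg_nonneg.2 hs) (neg_nonneg.2 (hwA t h).le),
        mul_nonneg (sub_nonneg.2 hm) (hzA t h).le]
    · have f1 := hca a ha t h
      have f2 := hcb a ha t h
      have hm := hmax (a, t) (mem_product.2 ⟨ha, h⟩)
      simp only at hm
      have hs : 0 ≤ s a b - s a t := by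
        have : (s a b - s a t) * w a = (c a t - c a b) * z a := by linarith
        have h3 : (c a t - c a b) * z a ≤ 0 :=
          mul_nonpos_of_nonpos_of_nonneg (by linarith) (hzA a ha).le
        by_contra! h4
        nlinarith [mul_pos (neg_pos.2 h4) (neg_pos.2 (hwA a ha))]
      nlinarith [mul_nonneg hs (hwB t h).le, mul_nonneg (sub_nonneg.2 hm) (hzB t h).le]
  refine ⟨(a, b), ⟨hab, c a b, s a b, hca a ha b hb, hcb a ha b hb, hbelow⟩, ?_⟩
  -- The positive weights `w b` and `-w a` eliminate the slope, leaving only the heights on the axis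
  -- to compare.
  · have key : ∀ c₁ s₁ c₂ s₂ : ℝ, ∀ a ∈ A, ∀ b ∈ B, y a = c₂ * z a + s₂ * w a →
        y b = c₂ * z b + s₂ * w b → y a ≤ c₁ * z a + s₁ * w a → y b ≤ c₁ * z b + s₁ * w b →
        c₂ ≤ c₁ := by
      intro c₁ s₁ c₂ s₂ a ha b hb e1 e2 f1 f2
      have h1 := mul_pos (hzA a ha) (hwB b hb)
      have h2 := mul_pos (hzB b hb) (neg_pos.2 (hwA a ha))
      have g1 := mul_le_mul_of_nonneg_right (e1 ▸ f1) (hwB b hb).le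
      have g2 := mul_le_mul_of_nonneg_right (e2 ▸ f2) (neg_nonneg.2 (hwA a ha).le)
      have : 0 ≤ (c₁ - c₂) * (z a * w b + z b * -w a) := by nlinarith
      by_contra! h
      nlinarith [mul_pos (sub_pos.2 h) (add_pos h1 h2)]
    have hmx : ∀ t ∈ A ∪ B, y t ≤ c a b * z t + s a b * w t := by
      intro t ht
      by_cases hta : t = a
      · subst hta; exact (hca _ ha b hb).le
      by_cases htb : t = b
      · subst htb; exact (hcb a ha _ hb).le
      exact (hbelow t ht hta htb).le
    rintro ⟨a', b'⟩ ⟨hab', c', s', h1, h2, h3⟩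
    obtain ⟨ha', hb'⟩ := mem_product.1 hab'
    simp only at ha' hb' h1 h2 h3
    have hmx' : ∀ t ∈ A ∪ B, y t ≤ c' * z t + s' * w t := by
      intro t ht
      by_cases hta : t = a'
      · subst hta; exact h1.le
      by_cases htb : t = b'
      · subst htb; exact h2.le
      exact (h3 t ht hta htb).le
    have hA' : ∀ t ∈ A, t ∈ A ∪ B := fun t h => mem_union_left _ h
    have hB' : ∀ t ∈ B, t ∈ A ∪ B := fun t h => mem_union_right _ h
    have hc : c' = c a b := le_antisymm
      (key _ _ _ _ a' ha' b' hb' h1 h2 (hmx _ (hA' _ ha')) (hmx _ (hB' _ hb')))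
      (key _ _ _ _ a ha b hb (hca a ha b hb) (hcb a ha b hb) (hmx' _ (hA' _ ha))
        (hmx' _ (hB' _ hb)))
    have hs : s' = s a b := by
      apply le_antisymm
      · have := h2 ▸ hmx _ (hB' _ hb')
        rw [hc] at this
        exact le_of_mul_le_mul_right (by linarith) (hwB b' hb')
      · have := h1 ▸ hmx _ (hA' _ ha')
        rw [hc] at this
        have h4 := neg_pos.2 (hwA a' ha')
        exact le_of_mul_le_mul_right (by linarith) h4
    rw [hc, hs] at h1 h2
    have q1 := hgen a ha b hb a' (hA' _ ha') _ _ (hca a ha b hb) (hcb a ha b hb) h1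
    have q2 := hgen a ha b hb b' (hB' _ hb') _ _ (hca a ha b hb) (hcb a ha b hb) h2
    have n1 : a' ≠ b := by rintro rfl; linarith [hwA _ ha', hwB _ hb]
    have n2 : b' ≠ a := by rintro rfl; linarith [hwA _ ha, hwB _ hb']
    rw [q1.resolve_right n1, q2.resolve_left n2]

/-! ### Finite counting and binomial moments -/

/-- The triples of a finite set, sorted by the value of an injective function. -/
theorem sum_powersetCard_three {α : Type*} [DecidableEq α] (R : Finset α) (f : α → ℝ)
    (hf : Set.InjOn f R) (g : Finset α → ℕ) :
    ∑ T ∈ R.powersetCard 3, g T = ∑ p ∈ R, ∑ x ∈ R.filter (fun q => f q < f p) ×ˢ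
      R.filter (fun r => f p < f r), g {p, x.1, x.2} := by
  rw [Finset.sum_sigma']
  symm
  refine Finset.sum_bij (fun (x : (_ : α) × α × α) _ => ({x.1, x.2.1, x.2.2} : Finset α)) ?_ ?_ ?_ ?_
  · rintro ⟨p, q, r⟩ h
    simp only [mem_sigma, mem_product, mem_filter] at h
    obtain ⟨hp, ⟨hq, h1⟩, hr, h2⟩ := h
    rw [mem_powersetCard]
    refine ⟨by simp [insert_subset_iff, *], card_eq_three.2 ⟨p, q, r, ?_, ?_, ?_, rfl⟩⟩ <;>
    · rintro rfl; linarith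
  · rintro ⟨p, q, r⟩ h ⟨p', q', r'⟩ h' he
    simp only [mem_sigma, mem_product, mem_filter] at h h'
    obtain ⟨hp, ⟨hq, h1⟩, hr, h2⟩ := h
    obtain ⟨hp', ⟨hq', h1'⟩, hr', h2'⟩ := h'
    simp only at he
    have m1 : p ∈ ({p', q', r'} : Finset α) := by rw [← he]; simp
    have m2 : q ∈ ({p', q', r'} : Finset α) := by rw [← he]; simp
    have m3 : r ∈ ({p', q', r'} : Finset α) := by rw [← he]; simp
    simp only [mem_insert, mem_singleton] at m1 m2 m3
    have : p = p' ∧ q = q' ∧ r = r' := by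
      rcases m1 with rfl | rfl | rfl <;> rcases m2 with rfl | rfl | rfl <;>
        rcases m3 with rfl | rfl | rfl <;> first | exact ⟨rfl, rfl, rfl⟩ | (exfalso; linarith)
    obtain ⟨rfl, rfl, rfl⟩ := this
    rfl
  · intro T hT
    obtain ⟨hTR, hc⟩ := mem_powersetCard.1 hT
    have main : ∀ p q r, T = {p, q, r} → f q < f p → f p < f r →
        ∃ x, ∃ _ : x ∈ R.sigma fun p => R.filter (fun q => f q < f p) ×ˢ
          R.filter (fun r => f p < f r), ({x.1, x.2.1, x.2.2} : Finset α) = T := by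
      rintro p q r rfl h1 h2
      simp only [insert_subset_iff, singleton_subset_iff] at hTR
      exact ⟨⟨p, q, r⟩, by simp [*], rfl⟩
    obtain ⟨a, b, c, hab, hac, hbc, rfl⟩ := card_eq_three.1 hc
    have hTR' := hTR
    simp only [insert_subset_iff, singleton_subset_iff] at hTR'
    obtain ⟨ha, hb, hc⟩ := hTR'
    have g1 : f a ≠ f b := fun h => hab (hf ha hb h)
    have g2 : f a ≠ f c := fun h => hac (hf ha hc h)
    have g3 : f b ≠ f c := fun h => hbc (hf hb hc h)
    rcases lt_or_gt_of_ne g1 with g1 | g1 <;> rcases lt_or_gt_of_ne g2 with g2 | g2 <;>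
      rcases lt_or_gt_of_ne g3 with g3 | g3
    · exact main b a c (by grind) g1 g3
    · exact main c a b (by grind) g2 g3
    · linarith
    · exact main a c b (by grind) g2 g1
    · exact main a b c (by grind) g1 g2
    · linarith
    · exact main c b a (by grind) g3 g2
    · exact main b c a (by grind) g3 g1
  · intros; rfl

/-- All but two elements of a finite set have both a smaller and a larger element. -/
theorem card_between {α : Type*} (R : Finset α) (f : α → ℝ) (hf : Set.InjOn f R)
    (hR : 2 ≤ R.card) :
    (R.filter fun p => (R.filter fun q => f q < f p).Nonempty ∧
      (R.filter fun r => f p < f r).Nonempty).card + 2 = R.card := by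
  have hne : R.Nonempty := card_pos.1 (by omega)
  obtain ⟨a, ha, hmin⟩ := R.exists_min_image f hne
  obtain ⟨b, hb, hmax⟩ := R.exists_max_image f hne
  have hab : a ≠ b := by
    rintro rfl
    have : R.card ≤ 1 := card_le_one.2 fun x hx y hy => hf hx hy
      (by linarith [hmin x hx, hmin y hy, hmax x hx, hmax y hy])
    omega
  have : (R.filter fun p => (R.filter fun q => f q < f p).Nonempty ∧
      (R.filter fun r => f p < f r).Nonempty) = (R.erase a).erase b := by
    ext p
    simp only [mem_filter, mem_erase]
    constructor
    · rintro ⟨hp, ⟨q, hq⟩, ⟨r, hr⟩⟩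
      rw [mem_filter] at hq hr
      refine ⟨?_, ?_, hp⟩
      · rintro rfl; linarith [hmax r hr.1]
      · rintro rfl; linarith [hmin q hq.1]
    · rintro ⟨h1, h2, hp⟩
      refine ⟨hp, ⟨a, mem_filter.2 ⟨ha, lt_of_le_of_ne (hmin p hp) fun h => h2 (hf hp ha h.symm)⟩⟩,
        ⟨b, mem_filter.2 ⟨hb, lt_of_le_of_ne (hmax p hp) fun h => h1 (hf hp hb h)⟩⟩⟩
  rw [this, card_erase_of_mem (mem_erase.2 ⟨hab.symm, hb⟩), card_erase_of_mem ha]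
  omega

/-- The number of sets of given size between two given sets. -/
theorem card_filter_powersetCard_between {α : Type*} [DecidableEq α] (S T U : Finset α) (s : ℕ) (hU : U ⊆ S)
    (hT : T ⊆ S) (hTU : Disjoint T U) :
    ((S.powersetCard (T.card + s)).filter fun R => T ⊆ R ∧ R \ T ⊆ U).card = U.card.choose s := by
  rw [← card_powersetCard]
  symm
  refine card_bij (fun V _ => T ∪ V) ?_ ?_ ?_
  · intro V hV
    obtain ⟨h1, h2⟩ := mem_powersetCard.1 hV
    refine mem_filter.2 ⟨mem_powersetCard.2 ⟨union_subset hT (h1.trans hU), ?_⟩,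
      subset_union_left, ?_⟩
    · rw [card_union_of_disjoint (hTU.mono_right h1), h2]
    · intro x hx
      simp only [mem_sdiff, mem_union] at hx
      exact h1 (hx.1.resolve_left hx.2)
  · intro V hV V' hV' h
    have h1 := (mem_powersetCard.1 hV).1
    have h2 := (mem_powersetCard.1 hV').1
    have d1 := hTU.mono_right h1
    have d2 := hTU.mono_right h2
    rw [← union_sdiff_cancel_left d1, ← union_sdiff_cancel_left d2]
    exact congrArg (· \ T) h
  · intro R hR
    obtain ⟨h1, h2, h3⟩ := mem_filter.1 hR
    refine ⟨R \ T, mem_powersetCard.2 ⟨h3, ?_⟩, union_sdiff_of_subset h2⟩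
    rw [card_sdiff_of_subset h2, (mem_powersetCard.1 h1).2]
    omega

/-- Identifies the counts `(k + 1) * (m - k)` by their moments. Raising `m` by one adds the sum
`h1`, a hockey-stick identity in view of `(k + 1) * k.choose s = (s + 1) * (k + 1).choose (s + 1)`.
-/
theorem sum_mul_choose_eq (m s : ℕ) :
    ∑ k ∈ range m, (k + 1) * (m - k) * k.choose s = (s + 1) * (m + 2).choose (s + 3) := by
  have h1 : ∀ m, ∑ k ∈ range m, (k + 1) * k.choose s = (s + 1) * (m + 1).choose (s + 2) := by
    intro m
    induction m with
    | zero => simp [Nat.choose_eq_zero_of_lt]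
    | succ m ih =>
      rw [sum_range_succ, ih, Nat.choose_succ_succ' (m + 1) (s + 1), Nat.add_one_mul_choose_eq]
      ring
  induction m with
  | zero => simp [Nat.choose_eq_zero_of_lt]
  | succ m ih =>
    have : ∑ k ∈ range (m + 1), (k + 1) * (m + 1 - k) * k.choose s =
        ∑ k ∈ range m, (k + 1) * (m - k) * k.choose s +
          ∑ k ∈ range (m + 1), (k + 1) * k.choose s := by
      rw [sum_range_succ, sum_range_succ _ m, ← add_assoc, ← sum_add_distrib]
      congr 1
      · refine sum_congr rfl fun k hk => ?_
        have := mem_range.1 hk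
        rw [show m + 1 - k = (m - k) + 1 by omega]
        ring
      · simp
    rw [this, ih, h1, Nat.choose_succ_succ' (m + 2) (s + 2)]
    ring

/-- A finite sequence is determined by its binomial moments. -/
theorem eq_of_sum_mul_choose_eq (m : ℕ) (a b : ℕ → ℕ)
    (h : ∀ s < m, ∑ k ∈ range m, a k * k.choose s = ∑ k ∈ range m, b k * k.choose s) :
    ∀ k < m, a k = b k := by
  induction m with
  | zero => simp
  | succ m ih =>
    -- The moment of order `m` sees only the last term.
    have hm : a m = b m := by
      have := h m (by omega)
      rw [sum_range_succ, sum_range_succ, sum_eq_zero, sum_eq_zero] at this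
      · simpa using this
      all_goals
        intro k hk
        rw [Nat.choose_eq_zero_of_lt (mem_range.1 hk), mul_zero]
    intro k hk
    rcases Nat.lt_succ_iff_lt_or_eq.1 hk with h1 | rfl
    · refine ih (fun s hs => ?_) k h1
      have := h s (by omega)
      rw [sum_range_succ, sum_range_succ, hm] at this
      omega
    · exact hm


/-! ### Circles through three points and their power function -/

theorem InGeneralPosition.mono {S R : Finset Plane} (h : InGeneralPosition S) (hR : R ⊆ S) :
    InGeneralPosition R :=
  ⟨fun T hT => h.1 T (hT.trans hR), fun T hT => h.2 T (hT.trans hR)⟩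

/-- A circle through all points of `T`, if there is one. -/
noncomputable def circleThrough (T : Finset Plane) : Sphere Plane :=
  Classical.epsilon fun C : Sphere Plane => ∀ p ∈ T, p ∈ C

theorem mem_circleThrough {T : Finset Plane} (hT : T.card = 3)
    (hc : ¬ Collinear ℝ (T : Set Plane)) : ∀ p ∈ T, p ∈ circleThrough T := by
  refine Classical.epsilon_spec (p := fun C : Sphere Plane => ∀ p ∈ T, p ∈ C) ?_
  obtain ⟨a, b, c, -, -, -, rfl⟩ := card_eq_three.1 hT
  have hi : AffineIndependent ℝ ![a, b, c] := by
    rw [affineIndependent_iff_not_collinear_set]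
    simpa using hc
  refine ⟨(Affine.Simplex.mk ![a, b, c] hi).circumsphere, fun p hp => ?_⟩
  have h := (Affine.Simplex.mk ![a, b, c] hi).mem_circumsphere
  simp only [mem_insert, mem_singleton] at hp
  rcases hp with rfl | rfl | rfl
  · exact h 0
  · exact h 1
  · exact h 2

theorem eq_circleThrough {T : Finset Plane} (hT : T.card = 3)
    (hc : ¬ Collinear ℝ (T : Set Plane)) {C : Sphere Plane} (hC : ∀ p ∈ T, p ∈ C) :
    C = circleThrough T := by
  have hm := mem_circleThrough hT hc
  obtain ⟨a, b, c, hab, hac, hbc, rfl⟩ := card_eq_three.1 hT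
  by_contra hne
  have := eq_of_mem_sphere_of_mem_sphere_of_finrank_eq_two (V := EuclideanSpace ℝ (Fin 2))
    (by simp) hne hab (hC a (by simp)) (hC b (by simp)) (hC c (by simp)) (hm a (by simp))
    (hm b (by simp)) (hm c (by simp))
  rcases this with h | h
  · exact hac h.symm
  · exact hbc h.symm

theorem radius_pos_of_mem {C : Sphere Plane} {p q : Plane} (h : p ≠ q) (hp : p ∈ C)
    (hq : q ∈ C) : 0 < C.radius := by
  rw [mem_sphere] at hp hq
  rcases (hp ▸ dist_nonneg : 0 ≤ C.radius).eq_or_lt with h0 | h0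
  · rw [← h0, dist_eq_zero] at hp hq
    exact (h (hp.trans hq.symm)).elim
  · exact h0

theorem InGeneralPosition.not_concyclic {S : Finset Plane} (h : InGeneralPosition S)
    {T : Finset Plane} (hTS : T ⊆ S) (hT : T.card = 3) {C : Sphere Plane} (hC : ∀ p ∈ T, p ∈ C)
    {t : Plane} (ht : t ∈ S) (htC : t ∈ C) : t ∈ T := by
  by_contra htT
  refine h.2 (insert t T) (insert_subset ht hTS) (by rw [card_insert_of_notMem htT, hT])
    ⟨⟨C.center, C.radius, fun p hp => ?_⟩, coplanar_of_finrank_eq_two _ (by simp)⟩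
  rw [mem_coe, mem_insert] at hp
  rcases hp with rfl | hp
  · exact htC
  · exact hC p hp

theorem dist_sq_sub_radius_sq_neg {C : Sphere Plane} (hr : 0 < C.radius) (t : Plane) :
    dist t C.center ^ 2 - C.radius ^ 2 < 0 ↔ dist t C.center < C.radius := by
  rw [sub_neg, sq_lt_sq₀ dist_nonneg hr.le]

theorem dist_sq_sub_radius_sq_pos {C : Sphere Plane} (hr : 0 < C.radius) (t : Plane) :
    0 < dist t C.center ^ 2 - C.radius ^ 2 ↔ C.radius < dist t C.center := by
  rw [sub_pos, sq_lt_sq₀ hr.le dist_nonneg]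

theorem plane_dist_sq (x y : Plane) : dist x y ^ 2 = (x 0 - y 0) ^ 2 + (x 1 - y 1) ^ 2 := by
  rw [EuclideanSpace.dist_sq_eq, Fin.sum_univ_two, Real.dist_eq, Real.dist_eq, sq_abs, sq_abs]

theorem det_ne_zero_of_not_collinear {p q r : Plane} (h : ¬ Collinear ℝ ({p, q, r} : Set Plane)) :
    (q 0 - p 0) * (r 1 - p 1) - (q 1 - p 1) * (r 0 - p 0) ≠ 0 := by
  intro hd
  apply h
  rw [collinear_iff_of_mem (p₀ := p) (by simp)]
  by_cases hqp : q = p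
  · refine ⟨r - p, ?_⟩
    rintro x (rfl | rfl | rfl)
    · exact ⟨0, by simp⟩
    · exact ⟨0, by simp [hqp]⟩
    · exact ⟨1, by simp⟩
  · refine ⟨q - p, ?_⟩
    have hn : (q 0 - p 0) ^ 2 + (q 1 - p 1) ^ 2 ≠ 0 := by
      rw [← plane_dist_sq]
      exact pow_ne_zero _ (dist_ne_zero.2 hqp)
    rintro x (rfl | rfl | rfl)
    · exact ⟨0, by simp⟩
    · exact ⟨1, by simp⟩
    · refine ⟨((q 0 - p 0) * (x 0 - p 0) + (q 1 - p 1) * (x 1 - p 1)) /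
        ((q 0 - p 0) ^ 2 + (q 1 - p 1) ^ 2), ?_⟩
      ext i
      simp only [vadd_eq_add, PiLp.add_apply, PiLp.smul_apply, PiLp.sub_apply, smul_eq_mul]
      rw [← sub_eq_iff_eq_add, div_mul_eq_mul_div, eq_div_iff hn]
      fin_cases i
      · simp only [Fin.zero_eta]
        linear_combination -(q 1 - p 1) * hd
      · simp only [Fin.mk_one]
        linear_combination (q 0 - p 0) * hd

/-- The power of a point with respect to the circle through `p`, `q`, `r`, from the plane through
the lifts of the three points to a paraboloid. -/
theorem mul_power_eq {p q r : Plane} (hcol : ¬ Collinear ℝ ({p, q, r} : Set Plane))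
    {C : Sphere Plane} (hp : p ∈ C) (hq : q ∈ C) (hr : r ∈ C) (t c s : ℝ)
    (eq : q 1 - p 1 = c * dist q p ^ 2 + s * ((q 0 - p 0) + t * (q 1 - p 1)))
    (er : r 1 - p 1 = c * dist r p ^ 2 + s * ((r 0 - p 0) + t * (r 1 - p 1))) :
    c ≠ 0 ∧ ∀ x : Plane, c * (dist x C.center ^ 2 - C.radius ^ 2) =
      c * dist x p ^ 2 + s * ((x 0 - p 0) + t * (x 1 - p 1)) - (x 1 - p 1) := by
  have hd := det_ne_zero_of_not_collinear hcol
  rw [mem_sphere] at hp hq hr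
  have hp' := congrArg (· ^ 2) hp
  have hq' := congrArg (· ^ 2) hq
  have hr' := congrArg (· ^ 2) hr
  simp only [plane_dist_sq] at *
  constructor
  · rintro rfl
    apply hd
    linear_combination -(r 0 - p 0 + t * (r 1 - p 1)) * eq + (q 0 - p 0 + t * (q 1 - p 1)) * er
  · intro x
    generalize C.radius ^ 2 = R at *
    generalize C.center 0 = u at *
    generalize C.center 1 = v at *
    -- The two sides of the goal differ by a linear form in `x - p`, as the quadratic parts cancel.
    -- `l1` and `l2` say that it kills the independent vectors `q - p` and `r - p`.
    have l1 : (-2 * c * (u - p 0) - s) * (q 0 - p 0) +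
        (-2 * c * (v - p 1) - s * t + 1) * (q 1 - p 1) = 0 := by
      linear_combination c * hq' - c * hp' + eq
    have l2 : (-2 * c * (u - p 0) - s) * (r 0 - p 0) +
        (-2 * c * (v - p 1) - s * t + 1) * (r 1 - p 1) = 0 := by
      linear_combination c * hr' - c * hp' + er
    have z1 : -2 * c * (u - p 0) - s = 0 := by
      apply (mul_eq_zero.1 _).resolve_right hd
      linear_combination (r 1 - p 1) * l1 - (q 1 - p 1) * l2
    have z2 : -2 * c * (v - p 1) - s * t + 1 = 0 := by
      apply (mul_eq_zero.1 _).resolve_right hd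
      linear_combination (q 0 - p 0) * l2 - (r 0 - p 0) * l1
    linear_combination c * hp' + (x 0 - p 0) * z1 + (x 1 - p 1) * z2

/-- A linear functional that separates the points of a finite set. -/
theorem exists_injOn_linear (S : Finset Plane) :
    ∃ t : ℝ, Set.InjOn (fun x : Plane => x 0 + t * x 1) S := by
  -- Only finitely many `t` identify two points; pairs with equal second coordinates merely exclude
  -- the extra value `0`.
  obtain ⟨t, ht⟩ := ((S ×ˢ S).image fun x : Plane × Plane =>
    -(x.1 0 - x.2 0) / (x.1 1 - x.2 1)).exists_notMem
  refine ⟨t, fun x hx y hy h => ?_⟩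
  simp only at h
  have h1 : x 1 = y 1 := by
    by_contra hne
    apply ht
    rw [mem_image]
    refine ⟨(x, y), mem_product.2 ⟨hx, hy⟩, ?_⟩
    rw [div_eq_iff (sub_ne_zero.2 hne)]
    linear_combination -h
  have h0 : x 0 = y 0 := by rw [h1] at h; linarith
  ext i
  fin_cases i
  · exact h0
  · exact h1


/-! ### Circles with all other points on one side -/

/-- All points of `R` outside `T` are in the interior of the circle through `T`. -/
def AllInside (R T : Finset Plane) : Prop :=
  ∀ u ∈ R, u ∉ T → dist u (circleThrough T).center < (circleThrough T).radius

/-- All points of `R` outside `T` are in the exterior of the circle through `T`. -/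
def AllOutside (R T : Finset Plane) : Prop :=
  ∀ u ∈ R, u ∉ T → (circleThrough T).radius < dist u (circleThrough T).center

/-- A point with smaller and larger neighbours is the middle point of exactly two triples
whose circle has all other points on one side. -/
theorem sum_empty_add_full_of_middle {R : Finset Plane} (hR : InGeneralPosition R) {t : ℝ}
    (hinj : Set.InjOn (fun x : Plane => x 0 + t * x 1) R) {p : Plane} (hp : p ∈ R)
    (hA : (R.filter fun q => q 0 + t * q 1 < p 0 + t * p 1).Nonempty)
    (hB : (R.filter fun r => p 0 + t * p 1 < r 0 + t * r 1).Nonempty) :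
    ∑ x ∈ (R.filter fun q => q 0 + t * q 1 < p 0 + t * p 1) ×ˢ
        (R.filter fun r => p 0 + t * p 1 < r 0 + t * r 1),
      ((if AllInside R {p, x.1, x.2} then 1 else 0) +
        (if AllOutside R {p, x.1, x.2} then 1 else 0)) = 2 := by
  set A := R.filter fun q : Plane => q 0 + t * q 1 < p 0 + t * p 1 with hAdef
  set B := R.filter fun r : Plane => p 0 + t * p 1 < r 0 + t * r 1 with hBdef
  -- Dividing `w` and `y` by `z` is inversion at `p` up to a shear.
  let y : Plane → ℝ := fun u => u 1 - p 1
  let z : Plane → ℝ := fun u => dist u p ^ 2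
  let w : Plane → ℝ := fun u => (u 0 - p 0) + t * (u 1 - p 1)
  have hAR : ∀ a ∈ A, a ∈ R := fun a ha => (mem_filter.1 ha).1
  have hBR : ∀ b ∈ B, b ∈ R := fun b hb => (mem_filter.1 hb).1
  have hwA : ∀ a ∈ A, w a < 0 := fun a ha => by
    have := (mem_filter.1 ha).2
    simp only [w]; linarith
  have hwB : ∀ b ∈ B, 0 < w b := fun b hb => by
    have := (mem_filter.1 hb).2
    simp only [w]; linarith
  have hw0 : w p = 0 := by simp [w]
  have hpA : ∀ a ∈ A, a ≠ p := by rintro a ha rfl; linarith [hwA a ha]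
  have hpB : ∀ b ∈ B, b ≠ p := by rintro b hb rfl; linarith [hwB b hb]
  have hzA : ∀ a ∈ A, 0 < z a := fun a ha => pow_pos (dist_pos.2 (hpA a ha)) 2
  have hzB : ∀ b ∈ B, 0 < z b := fun b hb => pow_pos (dist_pos.2 (hpB b hb)) 2
  have hAB : ∀ a ∈ A, ∀ b ∈ B, a ≠ b := by
    rintro a ha b hb rfl; linarith [hwA a ha, hwB a hb]
  have hcard : ∀ a ∈ A, ∀ b ∈ B, ({p, a, b} : Finset Plane).card = 3 := fun a ha b hb =>
    card_eq_three.2 ⟨p, a, b, (hpA a ha).symm, (hpB b hb).symm, hAB a ha b hb, rfl⟩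
  have hsub : ∀ a ∈ A, ∀ b ∈ B, ({p, a, b} : Finset Plane) ⊆ R := fun a ha b hb => by
    simp [insert_subset_iff, hp, hAR a ha, hBR b hb]
  have hcol : ∀ a ∈ A, ∀ b ∈ B, ¬ Collinear ℝ (({p, a, b} : Finset Plane) : Set Plane) :=
    fun a ha b hb => hR.1 _ (hsub a ha b hb) (hcard a ha b hb)
  have hmem := fun a ha b hb => mem_circleThrough (hcard a ha b hb) (hcol a ha b hb)
  have hpow : ∀ a ∈ A, ∀ b ∈ B, ∀ c s : ℝ, y a = c * z a + s * w a → y b = c * z b + s * w b →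
      c ≠ 0 ∧ ∀ x : Plane, c * (dist x (circleThrough {p, a, b}).center ^ 2 -
        (circleThrough {p, a, b}).radius ^ 2) = c * z x + s * w x - y x := by
    intro a ha b hb c s e1 e2
    have hc := hcol a ha b hb
    rw [coe_insert, coe_insert, coe_singleton] at hc
    exact mul_power_eq hc (hmem a ha b hb _ (by simp)) (hmem a ha b hb _ (by simp))
      (hmem a ha b hb _ (by simp)) t c s e1 e2
  have hunion : ∀ u, u ∈ A ∪ B ↔ u ∈ R ∧ u ≠ p := by
    intro u
    rw [mem_union, mem_filter, mem_filter]
    constructor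
    · rintro (h | h)
      · exact ⟨h.1, by rintro rfl; exact lt_irrefl _ h.2⟩
      · exact ⟨h.1, by rintro rfl; exact lt_irrefl _ h.2⟩
    · rintro ⟨h1, h2⟩
      rcases lt_trichotomy (u 0 + t * u 1) (p 0 + t * p 1) with h | h | h
      · exact Or.inl ⟨h1, h⟩
      · exact (h2 (hinj h1 hp h)).elim
      · exact Or.inr ⟨h1, h⟩
  have hgen : ∀ a ∈ A, ∀ b ∈ B, ∀ u ∈ A ∪ B, ∀ c s : ℝ, y a = c * z a + s * w a →
      y b = c * z b + s * w b → y u = c * z u + s * w u → u = a ∨ u = b := by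
    intro a ha b hb u hu c s e1 e2 e3
    obtain ⟨hc, h⟩ := hpow a ha b hb c s e1 e2
    obtain ⟨huR, hup⟩ := (hunion u).1 hu
    have h0 := h u
    rw [← e3, sub_self] at h0
    have h1 := (mul_eq_zero.1 h0).resolve_left hc
    have hr := radius_pos_of_mem (hpA a ha) (hmem a ha b hb _ (by simp))
      (hmem a ha b hb _ (by simp))
    have h2 : u ∈ circleThrough {p, a, b} := by
      rw [mem_sphere]
      exact (sq_eq_sq₀ dist_nonneg hr.le).1 (sub_eq_zero.1 h1)
    have := hR.not_concyclic (hsub a ha b hb) (hcard a ha b hb) (hmem a ha b hb) huR h2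
    simpa [hup] using this
  obtain ⟨x₁, hx₁, hu₁⟩ := existsUnique_supporting_pair A B hA hB w y z hzA hzB hwA hwB hgen
  -- Negating `y` gives the lower hull edge.
  obtain ⟨x₂, hx₂, hu₂⟩ := existsUnique_supporting_pair A B hA hB w (fun u => -y u) z hzA hzB
    hwA hwB (fun a ha b hb u hu c s e1 e2 e3 => hgen a ha b hb u hu (-c) (-s)
      (by linarith) (by linarith) (by linarith))
  -- The sum of indicators also covers `x₁ = x₂`, which occurs when `R` has three points.
  have hterm : ∀ x ∈ A ×ˢ B, ((if AllInside R {p, x.1, x.2} then 1 else 0) +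
      (if AllOutside R {p, x.1, x.2} then 1 else 0)) =
      (if x = x₁ then 1 else 0) + (if x = x₂ then 1 else 0) := by
    rintro ⟨a, b⟩ hab
    obtain ⟨ha, hb⟩ := mem_product.1 hab
    simp only at ha hb ⊢
    obtain ⟨c, s, ⟨e1, e2⟩, huniq⟩ := existsUnique_coefficients (yq := y a) (yr := y b)
      (hzA a ha) (hzB b hb) (hwA a ha) (hwB b hb)
    obtain ⟨hc, h⟩ := hpow a ha b hb c s e1 e2
    have hr := radius_pos_of_mem (hpA a ha) (hmem a ha b hb _ (by simp))
      (hmem a ha b hb _ (by simp))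
    have hiff : ∀ u, (u ∈ R ∧ u ∉ ({p, a, b} : Finset Plane)) ↔ u ∈ A ∪ B ∧ u ≠ a ∧ u ≠ b := by
      intro u
      rw [hunion]
      simp only [mem_insert, mem_singleton, not_or]
      tauto
    have i1 : (a, b) = x₁ ↔ ∀ u, (u ∈ R ∧ u ∉ ({p, a, b} : Finset Plane)) →
        y u < c * z u + s * w u := by
      constructor
      · rintro rfl u hu
        obtain ⟨-, c', s', f1, f2, f3⟩ := hx₁
        obtain ⟨rfl, rfl⟩ := huniq c' s' f1 f2
        obtain ⟨g1, g2, g3⟩ := (hiff u).1 hu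
        exact f3 u g1 g2 g3
      · intro hall
        exact hu₁ (a, b) ⟨hab, c, s, e1, e2, fun u g1 g2 g3 => hall u ((hiff u).2 ⟨g1, g2, g3⟩)⟩
    have i2 : (a, b) = x₂ ↔ ∀ u, (u ∈ R ∧ u ∉ ({p, a, b} : Finset Plane)) →
        c * z u + s * w u < y u := by
      constructor
      · rintro rfl u hu
        obtain ⟨-, c', s', f1, f2, f3⟩ := hx₂
        obtain ⟨rfl, rfl⟩ := huniq (-c') (-s') (by simp only at f1; linarith)
          (by simp only at f2; linarith)
        obtain ⟨g1, g2, g3⟩ := (hiff u).1 hu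
        have := f3 u g1 g2 g3
        linarith
      · intro hall
        exact hu₂ (a, b) ⟨hab, -c, -s, by simp only; linarith, by simp only; linarith,
          fun u g1 g2 g3 => by linarith [hall u ((hiff u).2 ⟨g1, g2, g3⟩)]⟩
    have j1 : AllInside R {p, a, b} ↔ ∀ u, (u ∈ R ∧ u ∉ ({p, a, b} : Finset Plane)) →
        dist u (circleThrough {p, a, b}).center ^ 2 - (circleThrough {p, a, b}).radius ^ 2 < 0 := by
      simp only [dist_sq_sub_radius_sq_neg hr, and_imp, AllInside]
    have j2 : AllOutside R {p, a, b} ↔ ∀ u, (u ∈ R ∧ u ∉ ({p, a, b} : Finset Plane)) →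
        0 < dist u (circleThrough {p, a, b}).center ^ 2 - (circleThrough {p, a, b}).radius ^ 2 := by
      simp only [dist_sq_sub_radius_sq_pos hr, and_imp, AllOutside]
    have k1 : ∀ u, y u < c * z u + s * w u ↔ 0 < c * (dist u (circleThrough {p, a, b}).center ^ 2 -
        (circleThrough {p, a, b}).radius ^ 2) := fun u => by rw [h, sub_pos]
    have k2 : ∀ u, c * z u + s * w u < y u ↔ c * (dist u (circleThrough {p, a, b}).center ^ 2 -
        (circleThrough {p, a, b}).radius ^ 2) < 0 := fun u => by rw [h, sub_neg]
    simp only [k1] at i1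
    simp only [k2] at i2
    -- The sign of `c` decides which hull edge means inside and which outside; the sum is the same
    -- either way.
    rcases lt_or_gt_of_ne hc with hneg | hpos
    · have m1 : ∀ d : ℝ, 0 < c * d ↔ d < 0 := fun d =>
        ⟨fun h => by by_contra! h'; nlinarith, fun h => mul_pos_of_neg_of_neg hneg h⟩
      have m2 : ∀ d : ℝ, c * d < 0 ↔ 0 < d := fun d =>
        ⟨fun h => by by_contra! h'; nlinarith, fun h => mul_neg_of_neg_of_pos hneg h⟩
      simp only [m1, ← j1] at i1
      simp only [m2, ← j2] at i2
      simp only [i1, i2]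
    · have m2 : ∀ d : ℝ, c * d < 0 ↔ d < 0 := fun d =>
        ⟨fun h => by by_contra! h'; nlinarith, fun h => mul_neg_of_pos_of_neg hpos h⟩
      simp only [mul_pos_iff_of_pos_left hpos, ← j2] at i1
      simp only [m2, ← j1] at i2
      simp only [i1, i2, add_comm]
  rw [sum_congr rfl hterm, sum_add_distrib, sum_ite_eq', sum_ite_eq', if_pos hx₁.1, if_pos hx₂.1]

/-- The number of empty circles plus the number of circles enclosing all other points. -/
theorem sum_empty_add_full {R : Finset Plane} (hR : InGeneralPosition R) {s : ℕ}
    (hcard : R.card = s + 3) :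
    ∑ T ∈ R.powersetCard 3, ((if AllInside R T then 1 else 0) +
      (if AllOutside R T then 1 else 0)) = 2 * (s + 1) := by
  obtain ⟨t, ht⟩ := exists_injOn_linear R
  rw [sum_powersetCard_three R _ ht]
  have hb := card_between R _ ht (by omega)
  have : ∀ p ∈ R, ∑ x ∈ (R.filter fun q => q 0 + t * q 1 < p 0 + t * p 1) ×ˢ
        (R.filter fun r => p 0 + t * p 1 < r 0 + t * r 1),
      ((if AllInside R {p, x.1, x.2} then 1 else 0) +
        (if AllOutside R {p, x.1, x.2} then 1 else 0)) =
      if ((R.filter fun q => q 0 + t * q 1 < p 0 + t * p 1).Nonempty ∧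
        (R.filter fun r => p 0 + t * p 1 < r 0 + t * r 1).Nonempty) then 2 else 0 := by
    intro p hp
    split_ifs with h
    · exact sum_empty_add_full_of_middle hR ht hp h.1 h.2
    · rw [not_and_or, not_nonempty_iff_eq_empty, not_nonempty_iff_eq_empty] at h
      rcases h with h | h <;> simp [h]
  rw [sum_congr rfl this, ← sum_filter, sum_const, smul_eq_mul]
  omega

/-! ### Distribution of interior and exterior points -/

/-- The points of `S` in the interior of the circle through `T`. -/
noncomputable def pointsInside (S T : Finset Plane) : Finset Plane :=
  S.filter fun u => dist u (circleThrough T).center < (circleThrough T).radius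

/-- The points of `S` in the exterior of the circle through `T`. -/
noncomputable def pointsOutside (S T : Finset Plane) : Finset Plane :=
  S.filter fun u => (circleThrough T).radius < dist u (circleThrough T).center

theorem InGeneralPosition.mem_circleThrough_iff {S T : Finset Plane} (hS : InGeneralPosition S)
    (hT : T ∈ S.powersetCard 3) {u : Plane} (hu : u ∈ S) : u ∈ circleThrough T ↔ u ∈ T := by
  obtain ⟨h1, h2⟩ := mem_powersetCard.1 hT
  have hm := mem_circleThrough h2 (hS.1 T h1 h2)
  exact ⟨fun h => hS.not_concyclic h1 h2 hm hu h, hm u⟩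

theorem card_inside_add_card_outside {S T : Finset Plane} (hS : InGeneralPosition S)
    (hT : T ∈ S.powersetCard 3) :
    (pointsInside S T).card + (pointsOutside S T).card + 3 = S.card := by
  obtain ⟨h1, h2⟩ := mem_powersetCard.1 hT
  have hon : (S.filter fun u => dist u (circleThrough T).center = (circleThrough T).radius) = T := by
    ext u
    rw [mem_filter, ← mem_sphere]
    exact ⟨fun h => (hS.mem_circleThrough_iff hT h.1).1 h.2,
      fun h => ⟨h1 h, (hS.mem_circleThrough_iff hT (h1 h)).2 h⟩⟩
  have e1 := card_filter_add_card_filter_not (s := S)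
    fun u => dist u (circleThrough T).center < (circleThrough T).radius
  have e2 := card_filter_add_card_filter_not
    (s := S.filter fun u => ¬ dist u (circleThrough T).center < (circleThrough T).radius)
    fun u => (circleThrough T).radius < dist u (circleThrough T).center
  rw [filter_filter, filter_filter] at e2
  have f1 : (S.filter fun u => ¬ dist u (circleThrough T).center < (circleThrough T).radius ∧
      (circleThrough T).radius < dist u (circleThrough T).center) = pointsOutside S T :=
    filter_congr fun u _ => ⟨fun h => h.2, fun h => ⟨h.le.not_gt, h⟩⟩
  have f2 : (S.filter fun u => ¬ dist u (circleThrough T).center < (circleThrough T).radius ∧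
      ¬ (circleThrough T).radius < dist u (circleThrough T).center) = T := by
    refine Eq.trans ?_ hon
    exact filter_congr fun u _ => ⟨fun h => le_antisymm (not_lt.1 h.2) (not_lt.1 h.1),
      fun h => ⟨h.not_lt, h.not_gt⟩⟩
  rw [f1, f2, h2] at e2
  rw [← e2] at e1
  rw [pointsInside]
  omega

/-- Double counting of pairs `T ⊆ R` with `R.card = s + 3`: for fixed `T`, the sets `R` with all
other points inside arise by adding `s` interior points to `T`, and likewise outside. -/
theorem sum_choose_inside_add_choose_outside {S : Finset Plane} (hS : InGeneralPosition S)
    (s : ℕ) :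
    ∑ T ∈ S.powersetCard 3, ((pointsInside S T).card.choose s +
      (pointsOutside S T).card.choose s) = 2 * ((s + 1) * S.card.choose (s + 3)) := by
  have h1 : ∑ R ∈ S.powersetCard (3 + s), ∑ T ∈ R.powersetCard 3,
      ((if AllInside R T then 1 else 0) + (if AllOutside R T then 1 else 0)) =
      2 * ((s + 1) * S.card.choose (s + 3)) := by
    rw [sum_congr rfl fun R hR => sum_empty_add_full (hS.mono (mem_powersetCard.1 hR).1)
      (by rw [(mem_powersetCard.1 hR).2, add_comm]), sum_const, card_powersetCard, smul_eq_mul,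
      add_comm 3 s]
    ring
  rw [← h1, sum_comm' (t' := S.powersetCard 3)
    (s' := fun T => (S.powersetCard (3 + s)).filter fun R => T ⊆ R)]
  · refine sum_congr rfl fun T hT => ?_
    obtain ⟨hTS, hT3⟩ := mem_powersetCard.1 hT
    have hon := fun u (hu : u ∈ T) => (hS.mem_circleThrough_iff hT (hTS hu)).2 hu
    rw [sum_add_distrib, ← card_filter, ← card_filter, filter_filter, filter_filter,
      ← card_filter_powersetCard_between S T (pointsInside S T) s (filter_subset _ _) hTS,
      ← card_filter_powersetCard_between S T (pointsOutside S T) s (filter_subset _ _) hTS, hT3]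
    · congr 2 <;>
      · refine filter_congr fun R hR => and_congr_right fun _ => ?_
        have hRS := (mem_powersetCard.1 hR).1
        constructor
        · intro h u g1 g2
          exact (mem_filter.1 (h (mem_sdiff.2 ⟨g1, g2⟩))).2
        · intro h u hu
          obtain ⟨g1, g2⟩ := mem_sdiff.1 hu
          exact mem_filter.2 ⟨hRS g1, h u g1 g2⟩
    · rw [disjoint_left]
      intro u hu hu'
      exact (mem_filter.1 hu').2.ne' (mem_sphere.1 (hon u hu))
    · rw [disjoint_left]
      intro u hu hu'
      exact (mem_filter.1 hu').2.ne (mem_sphere.1 (hon u hu))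
  · intro R T
    simp only [mem_powersetCard, mem_filter]
    exact ⟨fun h => ⟨⟨h.1, h.2.1⟩, h.2.1.trans h.1.1, h.2.2⟩, fun h => ⟨h.1.1, h.1.2, h.2.2⟩⟩

/-- The number of circles through three points of `S` with `k` points inside, plus the number of
those with `k` points outside. -/
theorem card_inside_eq_add_card_outside_eq {S : Finset Plane} (hS : InGeneralPosition S) {m : ℕ}
    (hm : S.card = m + 2) {k : ℕ} (hk : k < m) :
    ((S.powersetCard 3).filter fun T => (pointsInside S T).card = k).card +
      ((S.powersetCard 3).filter fun T => (pointsOutside S T).card = k).card =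
      2 * ((k + 1) * (m - k)) := by
  refine eq_of_sum_mul_choose_eq m (fun k =>
    ((S.powersetCard 3).filter fun T => (pointsInside S T).card = k).card +
      ((S.powersetCard 3).filter fun T => (pointsOutside S T).card = k).card)
    (fun k => 2 * ((k + 1) * (m - k))) (fun s _ => ?_) k hk
  have hfib : ∀ c : Finset Plane → ℕ, (∀ T ∈ S.powersetCard 3, c T < m) →
      ∑ k ∈ range m, ((S.powersetCard 3).filter fun T => c T = k).card * k.choose s =
        ∑ T ∈ S.powersetCard 3, (c T).choose s := by
    intro c hc
    rw [← sum_fiberwise_of_maps_to (t := range m) (g := c) fun T hT => mem_range.2 (hc T hT)]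
    refine sum_congr rfl fun k _ => ?_
    rw [sum_congr rfl fun T hT => by rw [(mem_filter.1 hT).2], sum_const, smul_eq_mul]
  have hlt := fun T hT => card_inside_add_card_outside (T := T) hS hT
  simp only [add_mul, sum_add_distrib]
  rw [hfib _ fun T hT => by have := hlt T hT; omega, hfib _ fun T hT => by have := hlt T hT; omega,
    ← sum_add_distrib, sum_choose_inside_add_choose_outside hS, hm, ← sum_mul_choose_eq, mul_sum]
  exact sum_congr rfl fun k _ => by ring

/-! ### Halving circles -/

theorem theorem1 (n : ℕ) (S : Finset Plane) (hcard : S.card = 2 * n + 1)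
    (hgen : InGeneralPosition S) :
    {C : EuclideanGeometry.Sphere Plane | IsHalvingCircle n S C}.encard = ((n ^ 2 : ℕ) : ℕ∞) := by
  have hset : ∀ P : Plane → Prop, {p : Plane | p ∈ S ∧ P p}.ncard = (S.filter P).card := by
    intro P
    rw [← Set.ncard_coe_finset]
    congr 1
    ext p
    simp
  -- For `n = 0` the condition on interior points reads `_ + 1 = 0`, so no circle is halving.
  rcases n with _ | n
  · rw [Set.encard_eq_zero.2]
    · simp
    · ext C
      simp only [Set.mem_ofPred_eq, Set.mem_empty_iff_false, iff_false]
      intro h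
      have := h.card_inside
      omega
  have hsum := fun T hT => card_inside_add_card_outside (T := T) hgen hT
  have hcount := card_inside_eq_add_card_outside_eq hgen (m := 2 * n + 1) (by omega) (k := n)
    (by omega)
  -- Interior and exterior points total `2 * n` here, so `n` inside is the same as `n` outside and
  -- `hcount` counts each circle twice.
  have heq : ((S.powersetCard 3).filter fun T => (pointsOutside S T).card = n) =
      (S.powersetCard 3).filter fun T => (pointsInside S T).card = n :=
    filter_congr fun T hT => by have := hsum T hT; omega
  rw [heq, show 2 * n + 1 - n = n + 1 by omega] at hcount
  have himage : {C : Sphere Plane | IsHalvingCircle (n + 1) S C} = circleThrough ''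
      ((S.powersetCard 3).filter fun T => (pointsInside S T).card = n : Finset (Finset Plane)) := by
    ext C
    simp only [Set.mem_ofPred_eq, Set.mem_image, mem_coe, mem_filter]
    constructor
    · intro h
      have h3 := h.card_on
      rw [hset] at h3
      have hT : S.filter (fun p => p ∈ C) ∈ S.powersetCard 3 :=
        mem_powersetCard.2 ⟨filter_subset _ _, h3⟩
      have hC := eq_circleThrough h3 (hgen.1 _ (filter_subset _ _) h3) (C := C)
        fun p hp => (mem_filter.1 hp).2
      refine ⟨_, ⟨hT, ?_⟩, hC.symm⟩
      have h4 := h.card_inside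
      rw [hset] at h4
      rw [pointsInside, ← hC]
      omega
    · rintro ⟨T, ⟨hT, hin⟩, rfl⟩
      obtain ⟨h1, h2⟩ := mem_powersetCard.1 hT
      have hm := mem_circleThrough h2 (hgen.1 T h1 h2)
      obtain ⟨a, b, c, hab, -, -, hTe⟩ := card_eq_three.1 h2
      refine ⟨radius_pos_of_mem hab (hm a (by simp [hTe])) (hm b (by simp [hTe])), ?_, ?_, ?_⟩
      · rw [hset, ← h2]
        congr 1
        ext u
        rw [mem_filter]
        exact ⟨fun h => (hgen.mem_circleThrough_iff hT h.1).1 h.2, fun h => ⟨h1 h, hm u h⟩⟩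
      · rw [hset]
        exact congrArg (· + 1) hin
      · rw [hset]
        have := hsum T hT
        rw [pointsOutside] at this
        omega
  rw [himage, Set.InjOn.encard_image, Set.encard_coe_eq_coe_finsetCard]
  · norm_cast
    nlinarith
  · intro T hT T' hT' h
    have g := (mem_filter.1 hT).1
    have g' := (mem_filter.1 hT').1
    have s1 := (mem_powersetCard.1 g).1
    have s2 := (mem_powersetCard.1 g').1
    ext u
    constructor
    · intro hu
      rw [← hgen.mem_circleThrough_iff g' (s1 hu), ← h, hgen.mem_circleThrough_iff g (s1 hu)]
      exact hu
    · intro hu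
      rw [← hgen.mem_circleThrough_iff g (s2 hu), h, hgen.mem_circleThrough_iff g' (s2 hu)]
      exact hu
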